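/- Repeated balls-into-bins (RBB). There are $n\ge 1$ bins and $m$ balls, and $x^t=(x^t_1,\dots,x^t_n)$ denotes the load vector after $t$ rounds, where $x^0$ is an arbitrary initial load vector, so $x^0_i\in\mathbb{Z}_{\ge 0}$ and $\sum_{i=1}^n x^0_i=m$. In each round one ball is removed from every non-empty bin and each of these balls is placed into a bin chosen independently and uniformly at random among all $n$ bins, that is, $$x_i^{t+1}=x_i^t-\mathbf 1_{x_i^t>0}+\sum_{j=1}^{\kappa^t}\mathbf 1_{z_j^t=i}\qquad(i=1,\dots,n),$$ where $\kappa^t=|\{i: x_i^t>0\}|$ and the $z_j^t$ are independent (over all $t$ and $j$) and uniform on $\{1,\dots,n\}$. Theorem (Stabilization). Let $c_r:=16\cdot 384^2\cdot 744^2$ and let $k\ge 1$ be a real number. There is a constant $C=C(k)>0$ such that for all integers $n\ge 1$ and $m$ with $n\le m\le n^k$, every initial load vector with $m$ balls, and every integer $t\ge c_r\cdot\frac{m^2}{n}$, $$\Pr\Big[\ \max_{1\le i\le n} x_i^s\le C\cdot\frac{m}{n}\cdot\log n\ \text{ for all integers } s \text{ with } t\le s\le t+m^2\ \Big]\ \ge\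 1-n^{-2k}.$$ -/

import Mathlib

/-- The number `κ` of non-empty bins of a load vector. -/
def nonemptyBins {n : ℕ} (x : Fin n → ℕ) : ℕ :=
  (Finset.univ.filter fun i => 0 < x i).card

/-- The maximum load of a load vector (`0` if there are no bins). -/
def maxLoad {n : ℕ} (x : Fin n → ℕ) : ℕ :=
  Finset.univ.sup x

/-- One round of repeated balls-into-bins: one ball is removed from each non-empty bin, and these
`κ = nonemptyBins x` balls are placed into the bins `z 0, …, z (κ - 1)` (note `κ ≤ n`; the
remaining entries of `z` are not used). -/
def rbbRound {n : ℕ} (x : Fin n → ℕ) (z : Fin n → Fin n) : Fin n → ℕ := fun i =>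
  x i - (if 0 < x i then 1 else 0) +
    (Finset.univ.filter fun j : Fin n => (j : ℕ) < nonemptyBins x ∧ z j = i).card

/-- `x` is the repeated balls-into-bins process on `n` bins, started from the load vector `x₀` and
driven by the samples `Z t j` (`t` the round, `j` the index of the re-allocated ball): all the
samples are independent and uniform over the bins, and the load vector `x (t + 1)` arises from
`x t` by one round that uses the samples `Z t`. -/
structure IsRBB {n : ℕ} {Ω : Type*} [MeasurableSpace Ω] (μ : MeasureTheory.Measure Ω)
    (x₀ : Fin n → ℕ) (Z : ℕ → Fin n → Ω → Fin n) (x : ℕ → Ω → Fin n → ℕ) : Prop where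
  measurable : ∀ t j, Measurable (Z t j)
  indep : ProbabilityTheory.iIndepFun (fun p : ℕ × Fin n => Z p.1 p.2) μ
  uniform : ∀ t j, μ.map (Z t j) = ProbabilityTheory.uniformOn (Set.univ : Set (Fin n))
  init : ∀ ω, x 0 ω = x₀
  step : ∀ t ω, x (t + 1) ω = rbbRound (x t ω) (fun j => Z t j ω)

/-- The constant `c_r` of the waiting time `c_r · m² / n`. -/
def convergenceConst : ℝ := 16 * 384 ^ 2 * 744 ^ 2

/-!
Write `r = m / n` for the average load. The load of a bin is a queue: over an interval of rounds
it changes by the number of balls it receives, minus the number of rounds, plus the number of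
rounds in which it is empty (`rbbProc_balance`). The theorem follows from two estimates, each of
which fails with a probability that is small enough for a union bound over polynomially many times
and bins.

*Empty bins.* Take a block of `ℓ ≈ 576 r²` rounds. At its start at least half of the bins have
load at most `2r`, whatever the configuration. The balls received by a bin during the block are at
most the samples, used or not, that point to it. The number of these samples has mean `ℓ` and
standard deviation about `√ℓ ≈ 24 r`, so with constant probability it falls short of `ℓ - 2r` by a
multiple of `r`. By the balance equation a bin of load at most `2r` is then empty for at least as
many rounds. The mean shortfall is bounded below by a comparison of second and fourth moments
(`expect_max_zero_ge`). The sum of the shortfalls changes by at most `2` when one sample changes,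
so by McDiarmid's inequality (`mcdiarmid`) the block contains at least `n r / 2` empty bins,
counted once per round, except with probability `exp (-n / 36928)`
(`measureReal_totalEmpty_lt_le`). Hence a fraction of order `1 / r` of the bins is empty on
average over time.

*Arrivals.* Given the past, the number of balls that a bin receives in a round is binomial with
mean the fraction of non-empty bins. An exponential supermartingale with parameter `α = 1 / (2308
r)` shows that over any interval the arrivals exceed `1 + α` times the number of rounds, minus the
time sum of the fraction of empty bins, by more than `L / α` with probability at most `exp (-L)`
(`measureReal_totalArrivals_gt_le`). The choice of `α` makes the gain from the empty bins dominate
the error term.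

By Lindley's recursion (`rbbProc_lindley`), the load of a bin at time `s` is governed by the
arrivals since it was last empty, which gives `O(r L)` with `L` of order `log n`. If it has not
been empty for `T ≈ 2308 m² / n` rounds, its load at the start of these was at most `m`, and the
negative drift of order `1 / r` per round has compensated for it since (`rbbProc_le_of_good`). The
independence of a block of samples from the past is used through
`integral_eq_integral_expect_extend`: resampling the block does not change expectations. For
bounded `n` the bound holds trivially, as no load exceeds `m`.
-/

/-! ### The process driven by a fixed array of samples -/

/-- The load vectors of the repeated balls-into-bins process started from `x₀`, as a function of
the array `w` of all samples: `w (t, j)` is the bin that receives the `j`-th ball of round `t`. -/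
def rbbProc {n : ℕ} (x₀ : Fin n → ℕ) (w : ℕ × Fin n → Fin n) : ℕ → Fin n → ℕ
  | 0 => x₀
  | t + 1 => rbbRound (rbbProc x₀ w t) (fun j => w (t, j))

/-- The number of balls that bin `i` receives in a round that starts from the load vector `x` and
uses the samples `z`. -/
def arrivals {n : ℕ} (x : Fin n → ℕ) (z : Fin n → Fin n) (i : Fin n) : ℕ :=
  (Finset.univ.filter fun j : Fin n => (j : ℕ) < nonemptyBins x ∧ z j = i).card

/-- The number of balls that bin `i` receives in the rounds `u, …, s - 1`. -/
def totalArrivals {n : ℕ} (x₀ : Fin n → ℕ) (w : ℕ × Fin n → Fin n) (i : Fin n) (u s : ℕ) : ℕ :=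
  ∑ v ∈ Finset.Ico u s, arrivals (rbbProc x₀ w v) (fun j => w (v, j)) i

/-- The number of pairs of a round among `u, …, s - 1` and a bin that is empty at the start of that
round. -/
def totalEmpty {n : ℕ} (x₀ : Fin n → ℕ) (w : ℕ × Fin n → Fin n) (u s : ℕ) : ℕ :=
  ∑ v ∈ Finset.Ico u s, (Finset.univ.filter fun i => rbbProc x₀ w v i = 0).card

section Deterministic

variable {n : ℕ} (x₀ : Fin n → ℕ) (w : ℕ × Fin n → Fin n)

lemma nonemptyBins_le (x : Fin n → ℕ) : nonemptyBins x ≤ n := by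
  simpa [nonemptyBins] using
    Finset.card_filter_le (Finset.univ : Finset (Fin n)) (fun i => 0 < x i)

lemma card_fin_lt {k : ℕ} (hk : k ≤ n) :
    (Finset.univ.filter fun j : Fin n => (j : ℕ) < k).card = k := by
  rw [Fin.card_filter_val_lt, min_eq_right hk]

lemma sum_rbbRound (x : Fin n → ℕ) (z : Fin n → Fin n) :
    ∑ i, rbbRound x z i = ∑ i, x i := by
  have h1 : ∑ i, arrivals x z i = nonemptyBins x := by
    rw [← card_fin_lt (nonemptyBins_le x)]
    rw [Finset.card_eq_sum_card_fiberwise (f := z) (t := Finset.univ)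
      (fun _ _ => Finset.mem_univ _)]
    refine Finset.sum_congr rfl fun i _ => ?_
    rw [arrivals, Finset.filter_filter]
  have h2 : nonemptyBins x = ∑ i, if 0 < x i then 1 else 0 := by
    simp [nonemptyBins]
  have h3 : ∑ i, rbbRound x z i
      = ∑ i, (x i - if 0 < x i then 1 else 0) + ∑ i, arrivals x z i := by
    rw [← Finset.sum_add_distrib]; rfl
  rw [h3, h1, h2, ← Finset.sum_add_distrib]
  refine Finset.sum_congr rfl fun i _ => ?_
  split_ifs <;> omega

lemma sum_rbbProc (t : ℕ) : ∑ i, rbbProc x₀ w t i = ∑ i, x₀ i := by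
  induction t with
  | zero => rfl
  | succ t ih => rw [rbbProc, sum_rbbRound, ih]

lemma rbbProc_le_sum (t : ℕ) (i : Fin n) : rbbProc x₀ w t i ≤ ∑ i, x₀ i := by
  rw [← sum_rbbProc x₀ w t]
  exact Finset.single_le_sum (fun _ _ => Nat.zero_le _) (Finset.mem_univ i)

lemma rbbProc_succ (t : ℕ) (i : Fin n) :
    rbbProc x₀ w (t + 1) i + 1 = rbbProc x₀ w t i +
      arrivals (rbbProc x₀ w t) (fun j => w (t, j)) i +
        (if rbbProc x₀ w t i = 0 then 1 else 0) := by
  have : rbbProc x₀ w (t + 1) i = rbbProc x₀ w t i - (if 0 < rbbProc x₀ w t i then 1 else 0) +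
      arrivals (rbbProc x₀ w t) (fun j => w (t, j)) i := rfl
  rw [this]
  split_ifs <;> omega

lemma rbbProc_congr {w w' : ℕ × Fin n → Fin n} {t : ℕ}
    (h : ∀ p : ℕ × Fin n, p.1 < t → w p = w' p) : rbbProc x₀ w t = rbbProc x₀ w' t := by
  induction t with
  | zero => rfl
  | succ t ih =>
    rw [rbbProc, rbbProc, ih fun p hp => h p (by omega)]
    congr 1
    funext j
    exact h (t, j) (by simp)

lemma totalArrivals_congr {w w' : ℕ × Fin n → Fin n} {u s : ℕ}
    (h : ∀ p : ℕ × Fin n, p.1 < s → w p = w' p) (i : Fin n) :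
    totalArrivals x₀ w i u s = totalArrivals x₀ w' i u s := by
  refine Finset.sum_congr rfl fun v hv => ?_
  rw [Finset.mem_Ico] at hv
  rw [rbbProc_congr x₀ (t := v) fun p hp => h p (by omega)]
  congr 1
  funext j
  exact h (v, j) hv.2

lemma totalEmpty_congr {w w' : ℕ × Fin n → Fin n} {u s : ℕ}
    (h : ∀ p : ℕ × Fin n, p.1 < s → w p = w' p) :
    totalEmpty x₀ w u s = totalEmpty x₀ w' u s := by
  refine Finset.sum_congr rfl fun v hv => ?_
  rw [Finset.mem_Ico] at hv
  rw [rbbProc_congr x₀ (t := v) fun p hp => h p (by omega)]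

lemma totalArrivals_succ (i : Fin n) {u s : ℕ} (h : u ≤ s) :
    totalArrivals x₀ w i u (s + 1) = totalArrivals x₀ w i u s +
      arrivals (rbbProc x₀ w s) (fun j => w (s, j)) i :=
  Finset.sum_Ico_succ_top h _

/-- Balance equation of a bin over an interval of rounds: every round removes one ball, except for
those in which the bin is empty. -/
lemma rbbProc_balance (i : Fin n) {u s : ℕ} (h : u ≤ s) :
    rbbProc x₀ w s i + (s - u) = rbbProc x₀ w u i + totalArrivals x₀ w i u s +
      ∑ v ∈ Finset.Ico u s, if rbbProc x₀ w v i = 0 then 1 else 0 := by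
  induction s, h using Nat.le_induction with
  | base => simp [totalArrivals]
  | succ s h ih =>
    rw [totalArrivals_succ x₀ w i h, Finset.sum_Ico_succ_top h]
    have := rbbProc_succ x₀ w s i
    omega

/-- Lindley's recursion: the load at time `s` is explained by the arrivals since the last time the
bin was empty or, if it was never empty since time `u₀`, by the load at time `u₀` and the
arrivals since then. -/
lemma rbbProc_lindley (i : Fin n) {u₀ s : ℕ} (h : u₀ ≤ s) :
    rbbProc x₀ w s i + (s - u₀) = rbbProc x₀ w u₀ i + totalArrivals x₀ w i u₀ s ∨
      ∃ u, u₀ ≤ u ∧ u ≤ s ∧ rbbProc x₀ w s i + (s - u) ≤ totalArrivals x₀ w i u s + 1 := by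
  induction s, h using Nat.le_induction with
  | base => left; simp [totalArrivals]
  | succ s h ih =>
    have hs := rbbProc_succ x₀ w s i
    by_cases h0 : rbbProc x₀ w s i = 0
    · right
      refine ⟨s, h, by omega, ?_⟩
      rw [totalArrivals_succ x₀ w i le_rfl]
      simp only [h0, if_true] at hs
      omega
    · rw [if_neg h0] at hs
      rcases ih with ih | ⟨u, hu, hus, ih⟩
      · left
        rw [totalArrivals_succ x₀ w i h]
        omega
      · right
        refine ⟨u, hu, by omega, ?_⟩
        rw [totalArrivals_succ x₀ w i hus]
        omega

lemma totalEmpty_eq_sum_idle (u s : ℕ) : totalEmpty x₀ w u s =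
    ∑ i, ∑ v ∈ Finset.Ico u s, if rbbProc x₀ w v i = 0 then 1 else 0 := by
  rw [Finset.sum_comm]
  simp [totalEmpty]

lemma totalEmpty_add {a b c : ℕ} (h : a ≤ b) (h' : b ≤ c) :
    totalEmpty x₀ w a b + totalEmpty x₀ w b c = totalEmpty x₀ w a c :=
  Finset.sum_Ico_consecutive _ h h'

lemma nonemptyBins_add_card_empty (x : Fin n → ℕ) :
    nonemptyBins x + (Finset.univ.filter fun i => x i = 0).card = n := by
  have := Finset.card_filter_add_card_filter_not (s := (Finset.univ : Finset (Fin n)))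
    (fun i => 0 < x i)
  simpa [nonemptyBins] using this

/-- The number of balls moved in the rounds `u, …, s - 1`. -/
lemma sum_nonemptyBins (u s : ℕ) :
    ∑ v ∈ Finset.Ico u s, nonemptyBins (rbbProc x₀ w v) + totalEmpty x₀ w u s = n * (s - u) := by
  rw [totalEmpty, ← Finset.sum_add_distrib,
    Finset.sum_congr rfl fun v _ => nonemptyBins_add_card_empty (rbbProc x₀ w v)]
  simp [mul_comm]

/-- A window of rounds composed of blocks of length `ℓ`, each of which contributes at least `b`
to the number of empty bins. -/
lemma totalEmpty_ge_of_blocks {ℓ u₀ s : ℕ} {b : ℝ}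
    (hb : ∀ v, u₀ ≤ v → v + ℓ ≤ s → b ≤ totalEmpty x₀ w v (v + ℓ)) (q : ℕ) :
    ∀ u, u₀ ≤ u → u + q * ℓ ≤ s → q * b ≤ totalEmpty x₀ w u s := by
  induction q with
  | zero => intro u _ _; simp
  | succ q ih =>
    intro u hu hus
    have e : (q + 1) * ℓ = q * ℓ + ℓ := by ring
    rw [e] at hus
    have h1 := ih (u + ℓ) (by omega) (by omega)
    have h2 := hb u hu (by omega)
    rw [← totalEmpty_add x₀ w (show u ≤ u + ℓ by omega) (show u + ℓ ≤ s by omega)]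
    push_cast
    linarith

/-- Counting all samples of the rounds, used or not, bounds the number of arrivals. -/
lemma totalArrivals_le (i : Fin n) (s ℓ : ℕ) : totalArrivals x₀ w i s (s + ℓ) ≤
    ∑ p : Fin ℓ × Fin n, if w (s + p.1, p.2) = i then 1 else 0 := by
  rw [totalArrivals, Finset.sum_Ico_eq_sum_range, Fintype.sum_prod_type, add_tsub_cancel_left,
    Finset.sum_range]
  simp only [Finset.sum_boole, Nat.cast_id, arrivals]
  refine Finset.sum_le_sum fun v _ => Finset.card_le_card fun j hj => ?_
  simp only [Finset.mem_filter, Finset.mem_univ, true_and] at hj ⊢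
  exact hj.2

/-- The bins of load at most `a` at time `s` are empty for at least as many rounds as their
arrivals fall short of the number of rounds. -/
lemma sum_shortfall_le_totalEmpty (s ℓ : ℕ) (a : ℝ) :
    ∑ i with (rbbProc x₀ w s i : ℝ) ≤ a,
      max 0 ((ℓ : ℝ) - a - ∑ p : Fin ℓ × Fin n, if w (s + p.1, p.2) = i then (1 : ℝ) else 0)
      ≤ totalEmpty x₀ w s (s + ℓ) := by
  rw [totalEmpty_eq_sum_idle, Nat.cast_sum]
  refine le_trans ?_ (Finset.sum_le_sum_of_subset_of_nonneg (Finset.filter_subset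
    (fun i => (rbbProc x₀ w s i : ℝ) ≤ a) _) fun _ _ _ => Nat.cast_nonneg _)
  refine Finset.sum_le_sum fun i hi => max_le (Nat.cast_nonneg _) ?_
  have h1 := rbbProc_balance x₀ w i (show s ≤ s + ℓ by omega)
  have h2 : ((totalArrivals x₀ w i s (s + ℓ) : ℕ) : ℝ) ≤
      ∑ p : Fin ℓ × Fin n, if w (s + p.1, p.2) = i then (1 : ℝ) else 0 := by
    exact_mod_cast totalArrivals_le x₀ w i s ℓ
  have h3 := (Finset.mem_filter.1 hi).2
  rw [add_tsub_cancel_left] at h1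
  have h4 : ((rbbProc x₀ w (s + ℓ) i + ℓ : ℕ) : ℝ) = _ := congrArg Nat.cast h1
  rw [Nat.cast_add, Nat.cast_add, Nat.cast_add] at h4
  have h5 : (0 : ℝ) ≤ rbbProc x₀ w (s + ℓ) i := Nat.cast_nonneg _
  linarith

/-- At least half of the bins have at most twice the average load. -/
lemma card_le_two_mul_average (x : Fin n → ℕ) {r : ℝ} (hr : 0 < r) (hx : (∑ i, x i : ℕ) = r * n) :
    (n : ℝ) / 2 ≤ (Finset.univ.filter fun i => (x i : ℝ) ≤ 2 * r).card := by
  have h1 := Finset.card_filter_add_card_filter_not (s := (Finset.univ : Finset (Fin n)))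
    (fun i => (x i : ℝ) ≤ 2 * r)
  have h2 : ((Finset.univ.filter fun i => ¬ (x i : ℝ) ≤ 2 * r).card : ℝ) * (2 * r) ≤ r * n := by
    rw [← hx, ← nsmul_eq_mul, Nat.cast_sum]
    refine le_trans (Finset.card_nsmul_le_sum _ (fun i => (x i : ℝ)) _ fun i hi => ?_)
      (Finset.sum_le_sum_of_subset_of_nonneg (Finset.filter_subset _ _)
        fun _ _ _ => Nat.cast_nonneg _)
    exact (not_le.1 (Finset.mem_filter.1 hi).2).le
  have h3 : ((Finset.univ.filter fun i => (x i : ℝ) ≤ 2 * r).card : ℝ) +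
      (Finset.univ.filter fun i => ¬ (x i : ℝ) ≤ 2 * r).card = n := by
    exact_mod_cast (by simpa using h1)
  have h4 : ((Finset.univ.filter fun i => ¬ (x i : ℝ) ≤ 2 * r).card : ℝ) * 2 ≤ n :=
    le_of_mul_le_mul_left (by linarith) hr
  linarith

end Deterministic

/-! ### Averages over finite product spaces -/

section FiniteProducts

open scoped BigOperators

variable {β : Type*} [Fintype β]

lemma expect_mono {γ : Type*} [Fintype γ] {f g : γ → ℝ} (h : ∀ a, f a ≤ g a) :
    𝔼 a, f a ≤ 𝔼 a, g a :=
  Finset.expect_le_expect fun a _ => h a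

lemma expect_fin_succ {N : ℕ} (f : (Fin (N + 1) → β) → ℝ) :
    𝔼 v, f v = 𝔼 v : Fin N → β, 𝔼 b, f (Fin.cons b v) := by
  rw [← Fintype.expect_equiv (Fin.consEquiv fun _ : Fin (N + 1) => β)
    (fun p => f (Fin.cons p.1 p.2)) f (fun _ => rfl)]
  rw [Finset.expect_comm, ← Finset.univ_product_univ,
    Finset.expect_product (f := fun p : β × (Fin N → β) => f (Fin.cons p.1 p.2))]

lemma expect_comp_equiv {ι : Type*} [Fintype ι] [DecidableEq ι] (f : (ι → β) → ℝ) :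
    𝔼 v, f v = 𝔼 v : Fin (Fintype.card ι) → β, f (v ∘ Fintype.equivFin ι) :=
  (Fintype.expect_equiv ((Fintype.equivFin ι).symm.arrowCongr (Equiv.refl β)) _ _
    fun v => by simp [Equiv.arrowCongr]).symm

lemma exp_le_add_exp_sq (x : ℝ) : Real.exp x ≤ x + Real.exp (x ^ 2) := by
  have h2 : x ^ 2 + 1 ≤ Real.exp (x ^ 2) := Real.add_one_le_exp _
  rcases le_or_gt |x| 1 with h | h
  · have h1 := (abs_le.1 (Real.abs_exp_sub_one_sub_id_le h)).2
    linarith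
  · rcases lt_abs.1 h with h | h
    · have : Real.exp x ≤ Real.exp (x ^ 2) := Real.exp_le_exp.2 (by nlinarith)
      linarith
    · have : Real.exp x ≤ 1 := Real.exp_le_one_iff.2 (by linarith)
      nlinarith

variable [Nonempty β]

lemma expect_exp_le_of_abs_le {f : β → ℝ} {c : ℝ} (hf : 𝔼 b, f b = 0) (hc : ∀ b, |f b| ≤ c) :
    𝔼 b, Real.exp (f b) ≤ Real.exp (c ^ 2) := by
  calc 𝔼 b, Real.exp (f b) ≤ 𝔼 b, (f b + Real.exp (c ^ 2)) := by
        refine expect_mono fun b => (exp_le_add_exp_sq _).trans ?_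
        have := Real.exp_le_exp.2 (sq_le_sq' (abs_le.1 (hc b)).1 (abs_le.1 (hc b)).2)
        linarith
    _ = _ := by rw [Finset.expect_add_distrib, hf, zero_add, Fintype.expect_const]

lemma abs_sub_expect_le {f : β → ℝ} {c : ℝ} (hc : ∀ b b', |f b - f b'| ≤ c) (b : β) :
    |f b - 𝔼 b', f b'| ≤ c := by
  have : f b - 𝔼 b', f b' = 𝔼 b', (f b - f b') := by
    rw [Finset.expect_sub_distrib, Fintype.expect_const]
  rw [this]
  refine (Finset.abs_expect_le _ _).trans ?_
  refine (expect_mono fun b' => hc b b').trans ?_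
  rw [Fintype.expect_const]

/-- `mcdiarmid` for coordinates indexed by `Fin N`. -/
lemma mcdiarmid_fin {c : ℝ} (θ : ℝ) (N : ℕ) :
    ∀ f : (Fin N → β) → ℝ, (∀ v i b, |f (Function.update v i b) - f v| ≤ c) →
      𝔼 v, Real.exp (θ * f v) ≤ Real.exp (θ * 𝔼 v, f v + θ ^ 2 * c ^ 2 * N) := by
  induction N with
  | zero =>
    intro f _
    simp
  | succ N ih =>
    intro f hf
    -- Averaging over the first coordinate keeps the bounded differences in the other ones.
    set g : (Fin N → β) → ℝ := fun v => 𝔼 b, f (Fin.cons b v) with hg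
    have hgc : ∀ v i b, |g (Function.update v i b) - g v| ≤ c := by
      intro v i b
      rw [hg, ← Finset.expect_sub_distrib]
      refine (Finset.abs_expect_le _ _).trans ?_
      refine (expect_mono (g := fun _ => c) fun b' => ?_).trans_eq (Fintype.expect_const _)
      rw [Fin.cons_update]
      exact hf _ _ _
    have hstep : ∀ v : Fin N → β, 𝔼 b, Real.exp (θ * f (Fin.cons b v)) ≤
        Real.exp (θ * g v) * Real.exp (θ ^ 2 * c ^ 2) := by
      intro v
      have h1 : ∀ b, Real.exp (θ * f (Fin.cons b v)) =
          Real.exp (θ * g v) * Real.exp (θ * (f (Fin.cons b v) - g v)) := fun b => by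
        rw [← Real.exp_add]; ring_nf
      simp_rw [h1]
      rw [← Finset.mul_expect]
      refine mul_le_mul_of_nonneg_left ?_ (Real.exp_pos _).le
      have h2 : 𝔼 b, θ * (f (Fin.cons b v) - g v) = 0 := by
        rw [← Finset.mul_expect, Finset.expect_sub_distrib, Fintype.expect_const, hg, sub_self,
          mul_zero]
      refine (expect_exp_le_of_abs_le (c := |θ| * c) h2 fun b => ?_).trans_eq ?_
      · rw [abs_mul]
        refine mul_le_mul_of_nonneg_left ?_ (abs_nonneg _)
        refine abs_sub_expect_le (f := fun b => f (Fin.cons b v)) (fun b b' => ?_) b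
        have := hf (Fin.cons b' v) 0 b
        rwa [Fin.update_cons_zero] at this
      · rw [mul_pow, sq_abs]
    rw [expect_fin_succ, expect_fin_succ]
    calc 𝔼 v : Fin N → β, 𝔼 b, Real.exp (θ * f (Fin.cons b v))
        ≤ 𝔼 v, Real.exp (θ * g v) * Real.exp (θ ^ 2 * c ^ 2) := expect_mono hstep
      _ = (𝔼 v, Real.exp (θ * g v)) * Real.exp (θ ^ 2 * c ^ 2) := by rw [Finset.expect_mul]
      _ ≤ Real.exp (θ * 𝔼 v, g v + θ ^ 2 * c ^ 2 * N) * Real.exp (θ ^ 2 * c ^ 2) :=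
        mul_le_mul_of_nonneg_right (ih g hgc) (Real.exp_pos _).le
      _ = _ := by rw [← Real.exp_add, hg]; push_cast; ring_nf

/-- The exponential moment form of McDiarmid's bounded differences inequality, with a non-optimal
constant. -/
theorem mcdiarmid {ι : Type*} [Fintype ι] [DecidableEq ι] {c : ℝ} (θ : ℝ) (f : (ι → β) → ℝ)
    (hf : ∀ v i b, |f (Function.update v i b) - f v| ≤ c) :
    𝔼 v, Real.exp (θ * f v) ≤
      Real.exp (θ * 𝔼 v, f v + θ ^ 2 * c ^ 2 * Fintype.card ι) := by
  rw [expect_comp_equiv, expect_comp_equiv f]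
  refine mcdiarmid_fin θ _ (fun v => f (v ∘ Fintype.equivFin ι)) fun v i b => ?_
  have : Function.update v i b ∘ Fintype.equivFin ι =
      Function.update (v ∘ Fintype.equivFin ι) ((Fintype.equivFin ι).symm i) b :=
    Function.update_comp_equiv v (Fintype.equivFin ι) i b
  rw [this]
  exact hf _ _ _

/-! ### Moments of sums of independent centred variables -/

/-- Mean, variance and a bound on the fourth moment of a sum of `N` independent copies of the
centred variable `ξ`. -/
lemma moments_fin {ξ : β → ℝ} (h0 : 𝔼 b, ξ b = 0) (N : ℕ) :
    𝔼 v : Fin N → β, ∑ i, ξ (v i) = 0 ∧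
    𝔼 v : Fin N → β, (∑ i, ξ (v i)) ^ 2 = N * 𝔼 b, ξ b ^ 2 ∧
    𝔼 v : Fin N → β, (∑ i, ξ (v i)) ^ 4 ≤
      N * 𝔼 b, ξ b ^ 4 + 3 * (N * 𝔼 b, ξ b ^ 2) ^ 2 := by
  induction N with
  | zero => simp
  | succ N ih =>
    obtain ⟨h1, h2, h4⟩ := ih
    simp only [expect_fin_succ, Fin.sum_univ_succ, Fin.cons_zero, Fin.cons_succ]
    refine ⟨?_, ?_, ?_⟩
    · simp only [Finset.expect_add_distrib, Fintype.expect_const, h0, h1, add_zero]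
    · have e : ∀ v : Fin N → β, 𝔼 b, (ξ b + ∑ i, ξ (v i)) ^ 2 =
          𝔼 b, ξ b ^ 2 + (∑ i, ξ (v i)) ^ 2 := by
        intro v
        have : ∀ b, (ξ b + ∑ i, ξ (v i)) ^ 2 =
            ξ b ^ 2 + ξ b * (2 * ∑ i, ξ (v i)) + (∑ i, ξ (v i)) ^ 2 := fun b => by ring
        simp_rw [this]
        rw [Finset.expect_add_distrib, Finset.expect_add_distrib, ← Finset.expect_mul, h0,
          Fintype.expect_const]
        ring
      simp_rw [e]
      rw [Finset.expect_add_distrib, h2, Fintype.expect_const]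
      push_cast
      ring
    · have e : ∀ v : Fin N → β, 𝔼 b, (ξ b + ∑ i, ξ (v i)) ^ 4 =
          𝔼 b, ξ b ^ 4 + (∑ i, ξ (v i)) * (4 * 𝔼 b, ξ b ^ 3) +
            (∑ i, ξ (v i)) ^ 2 * (6 * 𝔼 b, ξ b ^ 2) + (∑ i, ξ (v i)) ^ 4 := by
        intro v
        have : ∀ b, (ξ b + ∑ i, ξ (v i)) ^ 4 =
            ξ b ^ 4 + ξ b ^ 3 * (4 * ∑ i, ξ (v i)) + ξ b ^ 2 * (6 * (∑ i, ξ (v i)) ^ 2) +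
              ξ b * (4 * (∑ i, ξ (v i)) ^ 3) + (∑ i, ξ (v i)) ^ 4 := fun b => by ring
        simp_rw [this]
        simp only [Finset.expect_add_distrib, ← Finset.expect_mul, h0, Fintype.expect_const]
        ring
      simp_rw [e]
      simp only [Finset.expect_add_distrib, ← Finset.expect_mul, h1, h2, Fintype.expect_const]
      push_cast
      nlinarith [sq_nonneg (𝔼 b, ξ b ^ 2)]

/-- A lower bound for the mean of the positive part, from the second and fourth moments. -/
lemma expect_max_zero_ge {γ : Type*} [Fintype γ] {Y : γ → ℝ} {V : ℝ}
    (h1 : 𝔼 a, Y a = 0) (h2 : 𝔼 a, Y a ^ 2 = V) (h4 : 𝔼 a, Y a ^ 4 ≤ 4 * V ^ 2) (hV : 0 < V) :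
    √V / 4 ≤ 𝔼 a, max 0 (Y a) := by
  have hs : 0 < √V := Real.sqrt_pos.2 hV
  have hsq : √V ^ 2 = V := Real.sq_sqrt hV.le
  set K : ℝ := 4 / 3 * √V with hK
  have hK0 : 0 < K := by positivity
  -- With `u = |y| / K` this is `u * (2 * u - 3) ^ 2 * (u + 3) ≥ 0`.
  have key : ∀ y : ℝ, (y + (y ^ 2 / K - y ^ 4 * (4 / 27 / K ^ 3))) / 2 ≤ max 0 y := by
    intro y
    have h : y ^ 2 / K - y ^ 4 * (4 / 27 / K ^ 3) ≤ |y| := by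
      obtain ⟨u, hu⟩ : ∃ u, |y| = K * u := ⟨|y| / K, by field_simp⟩
      have hu0 : 0 ≤ u := by
        have := abs_nonneg y
        rw [hu] at this
        exact nonneg_of_mul_nonneg_right this hK0
      have e4 : y ^ 4 = |y| ^ 4 := by rw [← abs_pow, abs_of_nonneg (by positivity)]
      rw [e4, ← sq_abs y, hu]
      have e : (K * u) ^ 2 / K - (K * u) ^ 4 * (4 / 27 / K ^ 3) =
          K * (u ^ 2 - 4 / 27 * u ^ 4) := by field_simp
      rw [e]
      refine mul_le_mul_of_nonneg_left ?_ hK0.le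
      have : 0 ≤ u * ((2 * u - 3) ^ 2 * (u + 3)) := by positivity
      nlinarith
    rcases le_total 0 y with hy | hy
    · rw [abs_of_nonneg hy] at h; rw [max_eq_right hy]; linarith
    · rw [abs_of_nonpos hy] at h; rw [max_eq_left hy]; linarith
  refine le_trans ?_ (expect_mono fun a => key (Y a))
  rw [← Finset.expect_div, Finset.expect_add_distrib, Finset.expect_sub_distrib,
    ← Finset.expect_div, ← Finset.expect_mul, h1, h2]
  have h5 : (𝔼 a, Y a ^ 4) * (4 / 27 / K ^ 3) ≤ 4 * V ^ 2 * (4 / 27 / K ^ 3) :=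
    mul_le_mul_of_nonneg_right h4 (by positivity)
  have h6 : V / K - 4 * V ^ 2 * (4 / 27 / K ^ 3) = √V / 2 := by
    rw [hK, ← hsq]
    simp only [Real.sqrt_sq hs.le]
    field_simp
    norm_num
  linarith

/-- When balls, indexed by `ι`, are thrown into `n` bins, the count of bin `i` has variance `V`, and
the mean of its shortfall below the average count is of the order of `√V`. -/
lemma expect_max_zero_shortfall_ge {n : ℕ} (hn : 2 ≤ n) (i : Fin n) {ι : Type*} [Fintype ι]
    [DecidableEq ι] {V : ℝ} (hV : V = (Fintype.card ι : ℝ) * ((1 / n) * (1 - 1 / n)))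
    (hV1 : 1 ≤ V) :
    √V / 4 ≤ 𝔼 v : ι → Fin n,
      max 0 ((Fintype.card ι : ℝ) / n - ∑ p, if v p = i then (1 : ℝ) else 0) := by
  have hn0 : (0 : ℝ) < n := by positivity
  have hn1 : (1 : ℝ) / n ≤ 1 := by
    rw [div_le_one hn0]; exact_mod_cast (by omega : 1 ≤ n)
  have hnz : 0 ≤ (1 : ℝ) / n := by positivity
  have : Nonempty (Fin n) := ⟨i⟩
  have hi : ∀ a : ℝ, 𝔼 b : Fin n, (if b = i then a else 0) = a / n := by
    intro a
    rw [Fintype.expect_eq_sum_div_card]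
    simp
  obtain ⟨ξ, hξ⟩ : ∃ ξ : Fin n → ℝ, ξ = fun b => 1 / (n : ℝ) - if b = i then 1 else 0 := ⟨_, rfl⟩
  have h0 : 𝔼 b, ξ b = 0 := by
    rw [hξ, Finset.expect_sub_distrib, Fintype.expect_const, hi, sub_self]
  have h2 : 𝔼 b, ξ b ^ 2 = (1 / n) * (1 - 1 / n) := by
    have : ∀ b, ξ b ^ 2 = (1 / n) ^ 2 + if b = i then (1 - 2 * (1 / n) : ℝ) else 0 := by
      intro b; simp only [hξ]; split_ifs <;> ring
    simp_rw [this]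
    rw [Finset.expect_add_distrib, Fintype.expect_const, hi]
    ring
  have h4 : 𝔼 b, ξ b ^ 4 ≤ (1 / n) * (1 - 1 / n) := by
    rw [← h2]
    refine expect_mono fun b => ?_
    have hb : ξ b ^ 2 ≤ 1 := by
      rw [sq_le_one_iff_abs_le_one, abs_le, hξ]
      dsimp only
      split_ifs <;> constructor <;> linarith
    nlinarith [sq_nonneg (ξ b)]
  obtain ⟨m1, m2, m4⟩ := moments_fin h0 (Fintype.card ι)
  rw [h2, ← hV] at m2 m4
  have m4' : (Fintype.card ι : ℝ) * 𝔼 b, ξ b ^ 4 ≤ V := by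
    rw [hV]
    exact mul_le_mul_of_nonneg_left h4 (Nat.cast_nonneg _)
  have := expect_max_zero_ge m1 m2 (m4.trans (by nlinarith)) (by linarith)
  refine this.trans_eq (Eq.trans ?_ (expect_comp_equiv _).symm)
  refine Finset.expect_congr rfl fun v _ => ?_
  congr 1
  have e : ∑ p, (if (v ∘ Fintype.equivFin ι) p = i then (1 : ℝ) else 0) =
      ∑ q, if v q = i then (1 : ℝ) else 0 :=
    Fintype.sum_equiv (Fintype.equivFin ι) _ _ fun _ => rfl
  rw [e, hξ, Finset.sum_sub_distrib]
  simp [div_eq_mul_inv]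

end FiniteProducts

/-! ### Resampling independent uniform variables -/

section Resampling

open MeasureTheory ProbabilityTheory
open scoped BigOperators

variable {Ω : Type*} [MeasurableSpace Ω] {μ : Measure Ω} [IsProbabilityMeasure μ]
  {ι β κ : Type*} [Fintype β] [Nonempty β] [MeasurableSpace β] [MeasurableSingletonClass β]
  {Y : ι → Ω → β}

lemma integral_uniformOn_univ {γ : Type*} [Fintype γ] [Nonempty γ] [MeasurableSpace γ]
    [MeasurableSingletonClass γ] (f : γ → ℝ) :
    ∫ a, f a ∂(uniformOn (Set.univ : Set γ)) = 𝔼 a, f a := by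
  have : IsProbabilityMeasure (uniformOn (Set.univ : Set γ)) :=
    isProbabilityMeasure_uniformOn Set.finite_univ Set.univ_nonempty
  rw [integral_fintype .of_finite, Fintype.expect_eq_sum_div_card, Finset.sum_div]
  refine Finset.sum_congr rfl fun a _ => ?_
  rw [measureReal_def, uniformOn_univ]
  simp [div_eq_inv_mul]

/-- Resampling: if the `Y i` are independent and uniform, replacing finitely many of them, those
with index in the range of `e`, by fresh uniform samples `z` does not change the mean of a
function of the `Y i`. -/
theorem integral_eq_integral_expect_extend [Fintype κ] [DecidableEq κ]
    (hm : ∀ i, Measurable (Y i)) (hind : iIndepFun Y μ)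
    (hu : ∀ i, μ.map (Y i) = uniformOn Set.univ)
    {e : κ → ι} (he : e.Injective) (F : (ι → β) → ℝ) (T : Finset ι)
    (hF : DependsOn F (T : Set ι)) :
    ∫ ω, F (fun i => Y i ω) ∂μ = ∫ ω, 𝔼 z, F (Function.extend e z fun i => Y i ω) ∂μ := by
  classical
  obtain ⟨b₀⟩ := ‹Nonempty β›
  set S : Finset ι := Finset.univ.map ⟨e, he⟩ with hS
  have heS : ∀ k, e k ∈ S := fun k => by simp [hS]
  have hST : Disjoint S (T \ S) := Finset.disjoint_sdiff
  -- The values outside of `S`, completed by a constant where `F` does not look.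
  set c : ((T \ S : Finset ι) → β) → ι → β := fun v i => if h : i ∈ T \ S then v ⟨i, h⟩ else b₀
    with hc
  set U : Ω → κ → β := fun ω k => Y (e k) ω with hU
  set V : Ω → (T \ S : Finset ι) → β := fun ω i => Y i ω with hV
  have hFz : ∀ z ω, F (Function.extend e z fun i => Y i ω) =
      F (Function.extend e z (c (V ω))) := by
    intro z ω
    refine hF fun i hi => ?_
    by_cases h : ∃ k, e k = i
    · obtain ⟨k, rfl⟩ := h
      rw [he.extend_apply, he.extend_apply]
    · rw [Function.extend_apply' _ _ _ h, Function.extend_apply' _ _ _ h, hc]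
      have : i ∈ T \ S := by
        rw [Finset.mem_sdiff]
        refine ⟨hi, fun hiS => h ?_⟩
        simpa [hS] using hiS
      simp only [this, dite_true, hV]
  have hFω : ∀ ω, F (fun i => Y i ω) = F (Function.extend e (U ω) (c (V ω))) := by
    intro ω
    rw [← hFz]
    congr 1
    funext i
    by_cases h : ∃ k, e k = i
    · obtain ⟨k, rfl⟩ := h
      rw [he.extend_apply]
    · rw [Function.extend_apply' _ _ _ h]
  have hUm : Measurable U := measurable_pi_lambda _ fun k => hm _
  have hVm : Measurable V := measurable_pi_lambda _ fun i => hm _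
  have hUV : IndepFun U V μ := by
    have h := hind.indepFun_finset S (T \ S) hST hm
    have := h.comp (φ := fun (a : S → β) (k : κ) => a ⟨e k, heS k⟩) (ψ := id)
      (by fun_prop) measurable_id
    exact this
  have hUu : μ.map U = uniformOn Set.univ := by
    rw [(hind.precomp he).map_fun_eq_pi_map fun k => (hm _).aemeasurable]
    simp_rw [hu]
    rw [← uniformOn_pi, Set.pi_univ]
  have : IsProbabilityMeasure (μ.map V) := Measure.isProbabilityMeasure_map hVm.aemeasurable
  have : IsProbabilityMeasure (μ.map U) := Measure.isProbabilityMeasure_map hUm.aemeasurable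
  set G : (κ → β) × ((T \ S : Finset ι) → β) → ℝ :=
    fun p => F (Function.extend e p.1 (c p.2)) with hG
  have hGm : Measurable G := measurable_of_finite _
  calc ∫ ω, F (fun i => Y i ω) ∂μ = ∫ ω, G (U ω, V ω) ∂μ :=
        integral_congr_ae (Filter.Eventually.of_forall hFω)
    _ = ∫ p, G p ∂((μ.map U).prod (μ.map V)) := by
        rw [← (indepFun_iff_map_prod_eq_prod_map_map hUm.aemeasurable hVm.aemeasurable).1 hUV,
          integral_map (hUm.prodMk hVm).aemeasurable hGm.aestronglyMeasurable]
    _ = ∫ v, ∫ u, G (u, v) ∂(μ.map U) ∂(μ.map V) := integral_prod_symm G .of_finite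
    _ = ∫ v, 𝔼 u, G (u, v) ∂(μ.map V) := by
        rw [hUu]
        simp_rw [integral_uniformOn_univ]
    _ = ∫ ω, 𝔼 u, G (u, V ω) ∂μ :=
        integral_map hVm.aemeasurable (measurable_of_finite _).aestronglyMeasurable
    _ = _ := by simp_rw [hFz, hG]

omit [Fintype β] [MeasurableSpace β] [MeasurableSingletonClass β] in
lemma DependsOn.exists_factor {γ : Type*} {F : (ι → β) → γ} {T : Finset ι}
    (hF : DependsOn F (T : Set ι)) : ∃ G : (T → β) → γ, ∀ y, F y = G fun i => y i := by
  classical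
  obtain ⟨b₀⟩ := ‹Nonempty β›
  refine ⟨fun v => F fun i => if h : i ∈ T then v ⟨i, h⟩ else b₀, fun y => hF fun i hi => ?_⟩
  rw [dif_pos (Finset.mem_coe.1 hi)]

lemma measurable_comp_of_dependsOn (hm : ∀ i, Measurable (Y i)) {γ : Type*} [MeasurableSpace γ]
    {F : (ι → β) → γ} {T : Finset ι} (hF : DependsOn F (T : Set ι)) :
    Measurable fun ω => F fun i => Y i ω := by
  obtain ⟨G, hG⟩ := hF.exists_factor
  simp_rw [hG]
  have hV : Measurable fun ω (i : T) => Y i ω := measurable_pi_lambda _ fun i => hm _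
  exact (measurable_of_finite G).comp hV

lemma integrable_comp_of_dependsOn (hm : ∀ i, Measurable (Y i)) {F : (ι → β) → ℝ} {T : Finset ι}
    (hF : DependsOn F (T : Set ι)) : Integrable (fun ω => F fun i => Y i ω) μ := by
  obtain ⟨G, hG⟩ := hF.exists_factor
  simp_rw [hG]
  have hV : Measurable fun ω (i : T) => Y i ω := measurable_pi_lambda _ fun i => hm _
  have : IsProbabilityMeasure (μ.map fun ω (i : T) => Y i ω) :=
    Measure.isProbabilityMeasure_map hV.aemeasurable
  exact Integrable.comp_measurable (g := G) .of_finite hV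

end Resampling

/-! ### Many empty bins in every block of rounds -/

section Blocks

open MeasureTheory ProbabilityTheory
open scoped BigOperators

/-- When `n * ℓ` balls are thrown into `n` bins, the shortfalls of the counts of the bins below
`ℓ - 2 * r`, added up over a set `I` of at least half of the bins, are rarely less than
`n * r / 2`. For `ℓ ≈ 576 * r ^ 2` the standard deviation `√ℓ` of a count is a large multiple of
`r`, so that the mean of the sum is at least `n * r`, and the sum has bounded differences. -/
lemma expect_shortfall_small_le {n ℓ : ℕ} (hn : 2 ≤ n) {r : ℝ} (hr : 1 ≤ r)
    (hℓ : 576 * r ^ 2 ≤ ℓ) (hℓ' : ℓ ≤ 577 * r ^ 2) {I : Finset (Fin n)}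
    (hI : (n : ℝ) / 2 ≤ I.card) :
    𝔼 z : Fin ℓ × Fin n → Fin n, (if ∑ i ∈ I,
      max 0 ((ℓ : ℝ) - 2 * r - ∑ p, if z p = i then (1 : ℝ) else 0) < n * r / 2
        then (1 : ℝ) else 0) ≤ Real.exp (-(n / 36928)) := by
  have hn0 : (0 : ℝ) < n := by positivity
  have hn2 : (2 : ℝ) ≤ n := by exact_mod_cast hn
  have : Nonempty (Fin n) := ⟨⟨0, by omega⟩⟩
  set f : (Fin ℓ × Fin n → Fin n) → ℝ := fun z => ∑ i ∈ I,
      max 0 ((ℓ : ℝ) - 2 * r - ∑ p, if z p = i then (1 : ℝ) else 0) with hf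
  have hcard : (Fintype.card (Fin ℓ × Fin n) : ℝ) = ℓ * n := by simp
  have hmean : n * r ≤ 𝔼 z, f z := by
    have hterm : ∀ i ∈ I, 2 * r ≤ 𝔼 z : Fin ℓ × Fin n → Fin n,
        max 0 ((ℓ : ℝ) - 2 * r - ∑ p, if z p = i then (1 : ℝ) else 0) := by
      intro i _
      have hV : 256 * r ^ 2 ≤ (Fintype.card (Fin ℓ × Fin n) : ℝ) * ((1 / n) * (1 - 1 / n)) := by
        have e : (Fintype.card (Fin ℓ × Fin n) : ℝ) * ((1 / n) * (1 - 1 / n)) =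
            ℓ * (1 - 1 / n) := by
          rw [hcard]; field_simp
        have h2 : (1 : ℝ) / n ≤ 1 / 2 := by gcongr
        rw [e]
        nlinarith [sq_nonneg r]
      have h := expect_max_zero_shortfall_ge hn i (ι := Fin ℓ × Fin n) rfl (by nlinarith)
      have hs : 16 * r ≤ √((Fintype.card (Fin ℓ × Fin n) : ℝ) * ((1 / n) * (1 - 1 / n))) :=
        Real.le_sqrt_of_sq_le (by nlinarith)
      have hq : (Fintype.card (Fin ℓ × Fin n) : ℝ) / n = ℓ := by
        rw [hcard]; field_simp
      rw [hq] at h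
      have h3 : 𝔼 z : Fin ℓ × Fin n → Fin n,
          (max 0 ((ℓ : ℝ) - ∑ p, if z p = i then (1 : ℝ) else 0) - 2 * r) ≤
          𝔼 z : Fin ℓ × Fin n → Fin n,
            max 0 ((ℓ : ℝ) - 2 * r - ∑ p, if z p = i then (1 : ℝ) else 0) := by
        refine expect_mono fun z => ?_
        rw [sub_le_iff_le_add]
        refine max_le ?_ ?_
        · have := le_max_left 0 ((ℓ : ℝ) - 2 * r - ∑ p, if z p = i then (1 : ℝ) else 0)
          linarith
        · have := le_max_right 0 ((ℓ : ℝ) - 2 * r - ∑ p, if z p = i then (1 : ℝ) else 0)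
          linarith
      rw [Finset.expect_sub_distrib, Fintype.expect_const] at h3
      linarith
    rw [hf, Finset.expect_sum_comm]
    calc n * r = (n / 2) * (2 * r) := by ring
      _ ≤ I.card * (2 * r) := by gcongr
      _ = ∑ i ∈ I, 2 * r := by rw [Finset.sum_const, nsmul_eq_mul]
      _ ≤ _ := Finset.sum_le_sum hterm
  -- Moving one ball changes the counts of at most two bins, by one each.
  have hdiff : ∀ z p b, |f (Function.update z p b) - f z| ≤ 2 := by
    intro z p b
    have hcount : ∀ i, ∑ q, (if Function.update z p b q = i then (1 : ℝ) else 0) =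
        ∑ q, (if z q = i then (1 : ℝ) else 0) +
          ((if b = i then 1 else 0) - if z p = i then 1 else 0) := by
      intro i
      rw [← Finset.add_sum_erase _ _ (Finset.mem_univ p),
        ← Finset.add_sum_erase _ (fun q => if z q = i then (1 : ℝ) else 0) (Finset.mem_univ p),
        Function.update_self]
      have : ∑ q ∈ Finset.univ.erase p, (if Function.update z p b q = i then (1 : ℝ) else 0) =
          ∑ q ∈ Finset.univ.erase p, if z q = i then (1 : ℝ) else 0 :=
        Finset.sum_congr rfl fun q hq => by
          rw [Function.update_of_ne (Finset.ne_of_mem_erase hq)]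
      rw [this]
      ring
    rw [hf]
    dsimp only
    rw [← Finset.sum_sub_distrib]
    refine (Finset.abs_sum_le_sum_abs _ _).trans ?_
    have hone : ∀ i, |max 0 ((ℓ : ℝ) - 2 * r -
          ∑ q, if Function.update z p b q = i then (1 : ℝ) else 0) -
          max 0 ((ℓ : ℝ) - 2 * r - ∑ q, if z q = i then (1 : ℝ) else 0)| ≤
        (if b = i then 1 else 0) + if z p = i then 1 else 0 := by
      intro i
      rw [max_comm 0, max_comm 0, hcount]
      refine (abs_max_sub_max_le_abs _ _ _).trans ?_
      rw [abs_le]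
      split_ifs <;> constructor <;> linarith
    calc _ ≤ ∑ i ∈ I, ((if b = i then (1 : ℝ) else 0) + if z p = i then 1 else 0) :=
          Finset.sum_le_sum fun i _ => hone i
      _ ≤ ∑ i, ((if b = i then (1 : ℝ) else 0) + if z p = i then 1 else 0) :=
          Finset.sum_le_sum_of_subset_of_nonneg (Finset.subset_univ _) fun i _ _ => by
            split_ifs <;> norm_num
      _ = 2 := by
          rw [Finset.sum_add_distrib]
          simp
          norm_num
  -- The optimal exponent of the Chernoff bound.
  set θ : ℝ := -(1 / (9232 * r)) with hθ
  have hr0 : 0 < r := by linarith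
  have hθ0 : θ < 0 := by rw [hθ]; exact neg_neg_of_pos (by positivity)
  calc 𝔼 z, (if f z < n * r / 2 then (1 : ℝ) else 0)
      ≤ 𝔼 z, Real.exp (θ * f z) * Real.exp (-θ * (n * r / 2)) := by
        refine expect_mono fun z => ?_
        rw [← Real.exp_add]
        split_ifs with h
        · rw [← Real.exp_zero]
          exact Real.exp_le_exp.2 (by nlinarith)
        · exact (Real.exp_pos _).le
    _ = (𝔼 z, Real.exp (θ * f z)) * Real.exp (-θ * (n * r / 2)) := by rw [Finset.expect_mul]
    _ ≤ Real.exp (θ * 𝔼 z, f z + θ ^ 2 * 2 ^ 2 * Fintype.card (Fin ℓ × Fin n)) *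
          Real.exp (-θ * (n * r / 2)) :=
        mul_le_mul_of_nonneg_right (mcdiarmid θ f hdiff) (Real.exp_pos _).le
    _ ≤ _ := by
        rw [← Real.exp_add, hcard]
        refine Real.exp_le_exp.2 ?_
        have h1 : θ * 𝔼 z, f z ≤ θ * (n * r) := mul_le_mul_of_nonpos_left hmean hθ0.le
        have h2 : θ ^ 2 * 2 ^ 2 * (ℓ * n) ≤ θ ^ 2 * 2 ^ 2 * (577 * r ^ 2 * n) := by gcongr
        have h3 : θ * (n * r) + θ ^ 2 * 2 ^ 2 * (577 * r ^ 2 * n) + -θ * (n * r / 2) =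
            -(n / 36928) := by
          rw [hθ]; field_simp; norm_num
        linarith

/-- The indices of the samples of the rounds before `t`. -/
def samplesBefore (n t : ℕ) : Finset (ℕ × Fin n) := Finset.range t ×ˢ Finset.univ

lemma dependsOn_samplesBefore {n : ℕ} {γ : Type*} {f : (ℕ × Fin n → Fin n) → γ} {t : ℕ}
    (h : ∀ w w' : ℕ × Fin n → Fin n, (∀ p : ℕ × Fin n, p.1 < t → w p = w' p) → f w = f w') :
    DependsOn f (samplesBefore n t : Set (ℕ × Fin n)) := by
  intro w w' hw
  exact h w w' fun p hp => hw p (by simpa [samplesBefore] using hp)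

variable {Ω : Type*} [MeasurableSpace Ω] {μ : Measure Ω} [IsProbabilityMeasure μ]

/-- An event has probability at most `ε` if it has conditional probability at most `ε` when
finitely many of the independent uniform variables are resampled. -/
lemma measureReal_le_of_expect_extend_le {ι β κ : Type*} [Fintype β] [Nonempty β]
    [MeasurableSpace β] [MeasurableSingletonClass β] {Y : ι → Ω → β} [Fintype κ] [DecidableEq κ]
    (hm : ∀ i, Measurable (Y i)) (hind : iIndepFun Y μ)
    (hu : ∀ i, μ.map (Y i) = uniformOn Set.univ)
    {e : κ → ι} (he : e.Injective) (P : (ι → β) → Prop) [DecidablePred P] {T : Finset ι}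
    (hP : DependsOn P (T : Set ι)) {ε : ℝ}
    (hε : ∀ w, 𝔼 z, (if P (Function.extend e z w) then (1 : ℝ) else 0) ≤ ε) :
    μ.real {ω | P fun i => Y i ω} ≤ ε := by
  have hF : DependsOn (fun w => if P w then (1 : ℝ) else 0) (T : Set ι) := by
    intro w w' h
    have := hP h
    simp only [this]
  have hS : MeasurableSet {ω | P fun i => Y i ω} :=
    measurableSet_setOfPred.2 (measurable_comp_of_dependsOn hm hP)
  calc μ.real {ω | P fun i => Y i ω} = ∫ ω, (if P fun i => Y i ω then (1 : ℝ) else 0) ∂μ := by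
        rw [← integral_indicator_one hS]
        refine integral_congr_ae (Filter.Eventually.of_forall fun ω => ?_)
        simp [Set.indicator_apply]
    _ = _ := integral_eq_integral_expect_extend hm hind hu he _ T hF
    _ ≤ ∫ _, ε ∂μ := by
        refine integral_mono_of_nonneg (Filter.Eventually.of_forall fun ω => ?_)
          (integrable_const _) (Filter.Eventually.of_forall fun ω => hε _)
        exact Finset.expect_nonneg fun z _ => by split_ifs <;> norm_num
    _ = ε := by simp

variable {n : ℕ} [NeZero n] {Y : ℕ × Fin n → Ω → Fin n}

/-- A block of `ℓ ≈ 576 * r ^ 2` rounds, `r` being the average load, rarely sees few empty bins: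
half of the bins have load at most `2 * r` at its start, and a constant fraction of these receive
at most `ℓ - 4 * r` balls, as `r` is small compared to the standard deviation `√ℓ`. -/
theorem measureReal_totalEmpty_lt_le (hm : ∀ p, Measurable (Y p)) (hind : iIndepFun Y μ)
    (hu : ∀ p, μ.map (Y p) = uniformOn Set.univ) (x₀ : Fin n → ℕ) (hn : 2 ≤ n) {r : ℝ}
    (hr : 1 ≤ r) (hx : (∑ i, x₀ i : ℕ) = r * n) {ℓ : ℕ} (hℓ : 576 * r ^ 2 ≤ ℓ)
    (hℓ' : ℓ ≤ 577 * r ^ 2) (s : ℕ) :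
    μ.real {ω | (totalEmpty x₀ (fun p => Y p ω) s (s + ℓ) : ℝ) < n * r / 2} ≤
      Real.exp (-(n / 36928)) := by
  classical
  set e : Fin ℓ × Fin n → ℕ × Fin n := fun p => (s + p.1, p.2) with he
  have hei : e.Injective := by
    rintro ⟨a, b⟩ ⟨a', b'⟩ h
    simp only [he, Prod.mk.injEq, add_right_inj, Fin.val_inj] at h
    rw [h.1, h.2]
  refine measureReal_le_of_expect_extend_le hm hind hu hei
    (fun w => (totalEmpty x₀ w s (s + ℓ) : ℝ) < n * r / 2) (T := samplesBefore n (s + ℓ))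
    (dependsOn_samplesBefore fun w w' h => by rw [totalEmpty_congr x₀ h]) fun w => ?_
  have hI := card_le_two_mul_average (rbbProc x₀ w s) (by linarith)
    (by rw [sum_rbbProc]; exact hx)
  refine le_trans (expect_mono fun z => ?_) (expect_shortfall_small_le hn hr hℓ hℓ' hI)
  have h1 : rbbProc x₀ (Function.extend e z w) s = rbbProc x₀ w s := by
    refine rbbProc_congr x₀ fun p hp => Function.extend_apply' _ _ _ ?_
    rintro ⟨q, rfl⟩
    simp [he] at hp
  have h2 := sum_shortfall_le_totalEmpty x₀ (Function.extend e z w) s ℓ (2 * r)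
  have h3 : ∀ p : Fin ℓ × Fin n, Function.extend e z w (s + p.1, p.2) = z p := fun p =>
    hei.extend_apply z w p
  simp only [h1, h3] at h2
  split_ifs with ha hb
  · exact le_rfl
  · exact absurd (h2.trans_lt ha) hb
  · exact zero_le_one
  · exact le_rfl

/-! ### Exponential moments of the arrivals -/

lemma expect_exp_arrivals_le (α : ℝ) (x : Fin n → ℕ) (i : Fin n) :
    𝔼 z : Fin n → Fin n, Real.exp (α * arrivals x z i) ≤
      Real.exp ((Real.exp α - 1) / n * nonemptyBins x) := by
  have hn0 : (0 : ℝ) < n := by exact_mod_cast Nat.pos_of_ne_zero (NeZero.ne n)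
  have h1 : ∀ z : Fin n → Fin n, Real.exp (α * arrivals x z i) =
      ∏ j : Fin n, Real.exp (if (j : ℕ) < nonemptyBins x ∧ z j = i then α else 0) := by
    intro z
    rw [← Real.exp_sum, arrivals, Finset.card_filter, Nat.cast_sum, Finset.mul_sum]
    congr 1
    refine Finset.sum_congr rfl fun j _ => ?_
    split_ifs <;> simp
  have h2 : ∀ j : Fin n, (∑ b : Fin n,
      Real.exp (if (j : ℕ) < nonemptyBins x ∧ b = i then α else 0)) / n ≤
        Real.exp (if (j : ℕ) < nonemptyBins x then (Real.exp α - 1) / n else 0) := by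
    intro j
    by_cases hj : (j : ℕ) < nonemptyBins x
    · simp only [hj, true_and, if_true]
      have h3 : ∀ b : Fin n, Real.exp (if b = i then α else 0) =
          1 + if b = i then Real.exp α - 1 else 0 := by
        intro b; split_ifs <;> simp
      simp_rw [h3]
      rw [Finset.sum_add_distrib]
      simp only [Finset.sum_const, Finset.card_univ, Fintype.card_fin, nsmul_eq_mul, mul_one,
        Finset.sum_ite_eq', Finset.mem_univ, if_true]
      have := Real.add_one_le_exp ((Real.exp α - 1) / n)
      rw [add_div, div_self hn0.ne']
      linarith
    · simp [hj, hn0.ne']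
  have h4 : 𝔼 z : Fin n → Fin n, Real.exp (α * arrivals x z i) = ∏ j : Fin n, (∑ b : Fin n,
      Real.exp (if (j : ℕ) < nonemptyBins x ∧ b = i then α else 0)) / n := by
    simp_rw [h1]
    rw [Fintype.expect_eq_sum_div_card, Finset.prod_div_distrib, Finset.prod_univ_sum,
      Fintype.piFinset_univ]
    simp
  rw [h4]
  refine (Finset.prod_le_prod (fun j _ => by positivity) fun j _ => h2 j).trans_eq ?_
  rw [← Real.exp_sum, ← Finset.sum_filter, Finset.sum_const, card_fin_lt (nonemptyBins_le x),
    nsmul_eq_mul, mul_comm]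

omit [NeZero n] in
lemma dependsOn_exp_totalArrivals (x₀ : Fin n → ℕ) (α : ℝ) (i : Fin n) (u s : ℕ) :
    DependsOn (fun w => Real.exp (α * totalArrivals x₀ w i u s -
      (Real.exp α - 1) / n * (∑ v ∈ Finset.Ico u s, nonemptyBins (rbbProc x₀ w v) : ℕ)))
      (samplesBefore n s : Set (ℕ × Fin n)) := by
  refine dependsOn_samplesBefore fun w w' h => ?_
  have h2 : ∑ v ∈ Finset.Ico u s, nonemptyBins (rbbProc x₀ w v) =
      ∑ v ∈ Finset.Ico u s, nonemptyBins (rbbProc x₀ w' v) := by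
    refine Finset.sum_congr rfl fun v hv => ?_
    rw [rbbProc_congr x₀ fun p hp => h p (by have := (Finset.mem_Ico.1 hv).2; omega)]
  simp only [totalArrivals_congr x₀ h i, h2]

/-- The exponential supermartingale of the arrivals at a bin, compensated by the number of balls
that are moved. -/
lemma integral_exp_totalArrivals_le (hm : ∀ p, Measurable (Y p)) (hind : iIndepFun Y μ)
    (hu : ∀ p, μ.map (Y p) = uniformOn Set.univ) (x₀ : Fin n → ℕ) (α : ℝ) (i : Fin n) {u s : ℕ}
    (hus : u ≤ s) :
    ∫ ω, Real.exp (α * totalArrivals x₀ (fun p => Y p ω) i u s - (Real.exp α - 1) / n *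
      (∑ v ∈ Finset.Ico u s, nonemptyBins (rbbProc x₀ (fun p => Y p ω) v) : ℕ)) ∂μ ≤ 1 := by
  induction s, hus using Nat.le_induction with
  | base => simp [totalArrivals]
  | succ s hus ih =>
    refine le_trans ?_ ih
    have hei : (fun j : Fin n => (s, j)).Injective := fun j j' h => (Prod.mk.injEq _ _ _ _ ▸ h).2
    rw [integral_eq_integral_expect_extend hm hind hu hei (fun w => Real.exp (α *
      totalArrivals x₀ w i u (s + 1) - (Real.exp α - 1) / n *
      (∑ v ∈ Finset.Ico u (s + 1), nonemptyBins (rbbProc x₀ w v) : ℕ))) _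
      (dependsOn_exp_totalArrivals x₀ α i u (s + 1))]
    refine integral_mono_of_nonneg (Filter.Eventually.of_forall fun ω => ?_)
      (integrable_comp_of_dependsOn hm (dependsOn_exp_totalArrivals x₀ α i u s))
      (Filter.Eventually.of_forall fun ω => ?_)
    · exact Finset.expect_nonneg fun z _ => (Real.exp_pos _).le
    dsimp only
    set w : ℕ × Fin n → Fin n := fun p => Y p ω with hw
    have hbefore : ∀ z : Fin n → Fin n, ∀ p : ℕ × Fin n, p.1 < s →
        Function.extend (fun j : Fin n => (s, j)) z w p = w p := by
      intro z p hp
      refine Function.extend_apply' _ _ _ ?_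
      rintro ⟨q, rfl⟩
      simp at hp
    have hproc : ∀ z : Fin n → Fin n, ∀ v ≤ s,
        rbbProc x₀ (Function.extend (fun j : Fin n => (s, j)) z w) v = rbbProc x₀ w v :=
      fun z v hv => rbbProc_congr x₀ fun p hp => hbefore z p (by omega)
    have hstep : ∀ z : Fin n → Fin n,
        Real.exp (α * totalArrivals x₀ (Function.extend (fun j : Fin n => (s, j)) z w) i u (s + 1) -
          (Real.exp α - 1) / n * (∑ v ∈ Finset.Ico u (s + 1),
            nonemptyBins (rbbProc x₀ (Function.extend (fun j : Fin n => (s, j)) z w) v) : ℕ)) =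
        Real.exp (α * totalArrivals x₀ w i u s - (Real.exp α - 1) / n *
          (∑ v ∈ Finset.Ico u s, nonemptyBins (rbbProc x₀ w v) : ℕ)) *
        (Real.exp (α * arrivals (rbbProc x₀ w s) z i) *
          Real.exp (-((Real.exp α - 1) / n * nonemptyBins (rbbProc x₀ w s)))) := by
      intro z
      rw [totalArrivals_succ _ _ _ hus, totalArrivals_congr x₀ (hbefore z), hproc z s le_rfl,
        Finset.sum_congr rfl fun v hv => by
          rw [hproc z v (by have := (Finset.mem_Ico.1 hv).2; omega)],
        Finset.sum_Ico_succ_top hus]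
      simp_rw [hei.extend_apply]
      rw [← Real.exp_add, ← Real.exp_add]
      push_cast
      ring_nf
    simp_rw [hstep]
    rw [← Finset.mul_expect, ← Finset.expect_mul]
    refine mul_le_of_le_one_right (Real.exp_pos _).le ?_
    refine (mul_le_mul_of_nonneg_right (expect_exp_arrivals_le α _ i)
      (Real.exp_pos _).le).trans_eq ?_
    rw [← Real.exp_add, add_neg_cancel, Real.exp_zero]

/-- Chernoff bound for the arrivals at a bin, relative to the number of empty bins. -/
theorem measureReal_totalArrivals_gt_le (hm : ∀ p, Measurable (Y p)) (hind : iIndepFun Y μ)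
    (hu : ∀ p, μ.map (Y p) = uniformOn Set.univ) (x₀ : Fin n → ℕ) {α : ℝ} (hα : 0 < α)
    (hα1 : α ≤ 1) (L : ℝ) (i : Fin n) {u s : ℕ} (hus : u ≤ s) :
    μ.real {ω | L / α + (1 + α) * (s - u) - totalEmpty x₀ (fun p => Y p ω) u s / n <
      totalArrivals x₀ (fun p => Y p ω) i u s} ≤ Real.exp (-L) := by
  have hn0 : (0 : ℝ) < n := by exact_mod_cast Nat.pos_of_ne_zero (NeZero.ne n)
  set f : Ω → ℝ := fun ω => Real.exp (α * totalArrivals x₀ (fun p => Y p ω) i u s -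
      (Real.exp α - 1) / n *
      (∑ v ∈ Finset.Ico u s, nonemptyBins (rbbProc x₀ (fun p => Y p ω) v) : ℕ)) with hf
  have hfi : Integrable f μ :=
    integrable_comp_of_dependsOn hm (dependsOn_exp_totalArrivals x₀ α i u s)
  have hmarkov := mul_meas_ge_le_integral_of_nonneg
    (Filter.Eventually.of_forall fun ω => (Real.exp_pos _).le : 0 ≤ᵐ[μ] f) hfi (Real.exp L)
  have hint := hmarkov.trans (integral_exp_totalArrivals_le hm hind hu x₀ α i hus)
  have hsub : {ω | L / α + (1 + α) * (s - u) - totalEmpty x₀ (fun p => Y p ω) u s / n <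
      totalArrivals x₀ (fun p => Y p ω) i u s} ⊆ {ω | Real.exp L ≤ f ω} := by
    intro ω hω
    simp only [Set.mem_ofPred_eq] at hω ⊢
    refine Real.exp_le_exp.2 ?_
    have hsum := sum_nonemptyBins x₀ (fun p => Y p ω) u s
    set A : ℕ := totalArrivals x₀ (fun p => Y p ω) i u s
    set K : ℕ := ∑ v ∈ Finset.Ico u s, nonemptyBins (rbbProc x₀ (fun p => Y p ω) v)
    set E : ℕ := totalEmpty x₀ (fun p => Y p ω) u s
    have hsum' : (K : ℝ) + E = n * (s - u) := by
      rw [← Nat.cast_sub hus]; exact_mod_cast hsum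
    have hE : (0 : ℝ) ≤ E / n := by positivity
    have hKn : (K : ℝ) / n = (s - u) - E / n := by
      field_simp; linarith
    have hexp : Real.exp α - 1 ≤ α * (1 + α) := by
      have := (abs_le.1 (Real.abs_exp_sub_one_sub_id_le
        (by rw [abs_of_pos hα]; exact hα1 : |α| ≤ 1))).2
      linarith
    have h1 : (Real.exp α - 1) / n * K ≤ α * (1 + α) * ((s - u) - E / n) := by
      rw [← hKn, div_mul_eq_mul_div, mul_div_assoc]
      exact mul_le_mul_of_nonneg_right hexp (by positivity)
    have h2 : L + α * ((1 + α) * (s - u) - E / n) ≤ α * A := by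
      have := mul_le_mul_of_nonneg_left hω.le hα.le
      have e : α * (L / α + (1 + α) * (s - u) - E / n) =
          L + α * ((1 + α) * (s - u) - E / n) := by field_simp; ring
      linarith
    have h3 : 0 ≤ α * α * (E / n) := by positivity
    nlinarith
  have hle : μ.real {ω | Real.exp L ≤ f ω} ≤ Real.exp (-L) := by
    rw [Real.exp_neg, ← one_div, le_div_iff₀ (Real.exp_pos _), mul_comm]
    exact hint
  exact (measureReal_mono hsub).trans hle

end Blocks

/-! ### The maximum load -/

section MaxLoad

open MeasureTheory ProbabilityTheory

variable {Ω : Type*} [MeasurableSpace Ω] {μ : Measure Ω} [IsProbabilityMeasure μ]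

/-- The deterministic part: if all blocks of rounds starting in the window have many empty bins
and no bin receives too many balls, then all loads at the end of the window are small. The factor
`1 / (2308 * r)` is half the density of empty bins that the blocks guarantee. -/
lemma rbbProc_le_of_good {n : ℕ} [NeZero n] (x₀ : Fin n → ℕ) (w : ℕ × Fin n → Fin n) {r L : ℝ}
    (hr : 1 ≤ r) (hx : (∑ i, x₀ i : ℕ) = r * n) {ℓ T s : ℕ} (hℓ : 0 < ℓ)
    (hℓ' : ℓ ≤ 577 * r ^ 2) (hT : 2308 * r * (r * n) ≤ T) (hTs : T ≤ s)
    (hblock : ∀ v ∈ Finset.Icc (s - T) s, n * r / 2 ≤ totalEmpty x₀ w v (v + ℓ))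
    (harr : ∀ u ∈ Finset.Icc (s - T) s, ∀ i, (totalArrivals x₀ w i u s : ℝ) ≤
      L / (1 / (2308 * r)) + (1 + 1 / (2308 * r)) * (s - u) - totalEmpty x₀ w u s / n)
    (i : Fin n) : (rbbProc x₀ w s i : ℝ) ≤ 2308 * r * L + r / 2 + 1 := by
  have hn0 : (0 : ℝ) < n := by exact_mod_cast Nat.pos_of_ne_zero (NeZero.ne n)
  have hr0 : 0 < r := by linarith
  have hmain : ∀ u, s - T ≤ u → u ≤ s → (totalArrivals x₀ w i u s : ℝ) - (s - u) ≤
      2308 * r * L + min (r / 2) (r / 2 - (s - u) / (2308 * r)) := by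
    intro u hu hus
    have h1 := harr u (Finset.mem_Icc.2 ⟨hu, hus⟩) i
    set q : ℕ := (s - u) / ℓ with hq
    have hq1 : q * ℓ ≤ s - u := Nat.div_mul_le_self _ _
    have hq2 : s - u < ℓ * (q + 1) := Nat.lt_mul_div_succ _ hℓ
    have h2 := totalEmpty_ge_of_blocks x₀ w (u₀ := u) (s := s) (b := n * r / 2) (ℓ := ℓ)
      (fun v hv hvs => hblock v (Finset.mem_Icc.2 ⟨by omega, by omega⟩)) q u le_rfl (by omega)
    have h3 : q * (r / 2) ≤ totalEmpty x₀ w u s / n := by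
      rw [le_div_iff₀ hn0]; linarith
    have h4 : ((s : ℝ) - u) ≤ 577 * r ^ 2 * (q + 1) := by
      have : ((s - u : ℕ) : ℝ) ≤ ℓ * (q + 1) := by exact_mod_cast hq2.le
      rw [Nat.cast_sub hus] at this
      exact this.trans (by gcongr)
    have h5 : ((s : ℝ) - u) / (2308 * r) ≤ (q + 1) * (r / 4) := by
      rw [div_le_iff₀ (by positivity)]
      linarith
    have h6 : L / (1 / (2308 * r)) + (1 + 1 / (2308 * r)) * (s - u) =
        2308 * r * L + (s - u) + (s - u) / (2308 * r) := by
      field_simp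
      ring
    have h7 : (0 : ℝ) ≤ q * (r / 4) := by positivity
    rw [← min_add_add_left]
    exact le_min (by linarith) (by linarith)
  rcases rbbProc_lindley x₀ w i (Nat.sub_le s T) with h | ⟨u, hu, hus, h⟩
  · have h1 := hmain (s - T) le_rfl (Nat.sub_le _ _)
    have h2 := h1.trans (add_le_add_right (min_le_right _ _) _)
    have e : ((s - T : ℕ) : ℝ) = s - T := Nat.cast_sub hTs
    have h3 : ((rbbProc x₀ w (s - T) i : ℕ) : ℝ) ≤ r * n := by
      rw [← hx]; exact_mod_cast rbbProc_le_sum x₀ w (s - T) i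
    have h4 : (rbbProc x₀ w s i : ℝ) + T = rbbProc x₀ w (s - T) i +
        totalArrivals x₀ w i (s - T) s := by
      rw [Nat.sub_sub_self hTs] at h; exact_mod_cast h
    have h5 : r * n ≤ T / (2308 * r) := by
      rw [le_div_iff₀ (by positivity)]; linarith
    rw [e, sub_sub_cancel] at h2
    linarith
  · have h1 := (hmain u hu hus).trans (add_le_add_right (min_le_left _ _) _)
    have h2 : (rbbProc x₀ w s i : ℝ) + (s - u) ≤ totalArrivals x₀ w i u s + 1 := by
      rw [← Nat.cast_sub hus]; exact_mod_cast h
    linarith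

/-- The tail of the loads at one time `s`, which is at least the length `T` of the window after
which the initial configuration is forgotten. -/
theorem measureReal_exists_rbbProc_gt_le {n : ℕ} [NeZero n] {Y : ℕ × Fin n → Ω → Fin n}
    (hm : ∀ p, Measurable (Y p)) (hind : iIndepFun Y μ)
    (hu : ∀ p, μ.map (Y p) = uniformOn Set.univ) (x₀ : Fin n → ℕ) (hn : 2 ≤ n) {r L : ℝ}
    (hr : 1 ≤ r) (hx : (∑ i, x₀ i : ℕ) = r * n) {T s : ℕ}
    (hT : 2308 * r * (r * n) ≤ T) (hTs : T ≤ s) :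
    μ.real {ω | ∃ i, 2308 * r * L + r / 2 + 1 < rbbProc x₀ (fun p => Y p ω) s i} ≤
      (T + 1) * (Real.exp (-(n / 36928)) + n * Real.exp (-L)) := by
  have hr0 : 0 < r := by linarith
  set ℓ : ℕ := ⌈576 * r ^ 2⌉₊ with hℓ
  have hℓ1 : 576 * r ^ 2 ≤ ℓ := Nat.le_ceil _
  have hℓ2 : (ℓ : ℝ) ≤ 577 * r ^ 2 := by
    have := (Nat.ceil_lt_add_one (by positivity : 0 ≤ 576 * r ^ 2)).le
    nlinarith
  have hℓ0 : 0 < ℓ := Nat.ceil_pos.2 (by positivity)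
  set α : ℝ := 1 / (2308 * r) with hα
  have hα0 : 0 < α := by positivity
  have hα1 : α ≤ 1 := by
    rw [hα, div_le_one (by positivity)]; linarith
  set B : ℕ → Set Ω := fun v => {ω | (totalEmpty x₀ (fun p => Y p ω) v (v + ℓ) : ℝ) < n * r / 2}
    with hB
  set D : ℕ → Fin n → Set Ω := fun u i => {ω | L / α + (1 + α) * (s - u) -
      totalEmpty x₀ (fun p => Y p ω) u s / n < totalArrivals x₀ (fun p => Y p ω) i u s} with hD
  have hsub : {ω | ∃ i, 2308 * r * L + r / 2 + 1 < rbbProc x₀ (fun p => Y p ω) s i} ⊆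
      ⋃ u ∈ Finset.Icc (s - T) s, (B u ∪ ⋃ i ∈ (Finset.univ : Finset (Fin n)), D u i) := by
    intro ω ⟨i, hi⟩
    by_contra hnot
    simp only [Set.mem_iUnion, Set.mem_union, not_exists, not_or, hB, hD, Set.mem_ofPred_eq,
      not_lt] at hnot
    exact absurd hi (not_lt.2 (rbbProc_le_of_good x₀ _ hr hx hℓ0 hℓ2 hT hTs
      (fun v hv => (hnot v hv).1) (fun u hu i => (hnot u hu).2 i (Finset.mem_univ i)) i))
  have hone : ∀ u ∈ Finset.Icc (s - T) s,
      μ.real (B u ∪ ⋃ i ∈ (Finset.univ : Finset (Fin n)), D u i) ≤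
        Real.exp (-(n / 36928)) + n * Real.exp (-L) := by
    intro u hus
    refine (measureReal_union_le _ _).trans (add_le_add
      (measureReal_totalEmpty_lt_le hm hind hu x₀ hn hr hx hℓ1 hℓ2 u) ?_)
    refine (measureReal_biUnion_finset_le _ _).trans ?_
    refine (Finset.sum_le_card_nsmul _ _ _ fun i _ => measureReal_totalArrivals_gt_le hm hind hu x₀
      hα0 hα1 L i (Finset.mem_Icc.1 hus).2).trans_eq ?_
    simp
  refine (measureReal_mono hsub (measure_ne_top _ _)).trans
    ((measureReal_biUnion_finset_le _ _).trans ?_)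
  refine (Finset.sum_le_card_nsmul _ _ _ hone).trans_eq ?_
  rw [Nat.card_Icc, nsmul_eq_mul]
  congr 1
  have : s + 1 - (s - T) = T + 1 := by omega
  rw [this]
  push_cast
  rfl

omit [IsProbabilityMeasure μ] in
lemma IsRBB.eq_rbbProc {n : ℕ} {x₀ : Fin n → ℕ} {Z : ℕ → Fin n → Ω → Fin n}
    {x : ℕ → Ω → Fin n → ℕ} (h : IsRBB μ x₀ Z x) (t : ℕ) (ω : Ω) :
    x t ω = rbbProc x₀ (fun p => Z p.1 p.2 ω) t := by
  induction t with
  | zero => exact h.init ω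
  | succ t ih => rw [h.step, ih]; rfl

lemma maxLoad_le_sum {n : ℕ} (x : Fin n → ℕ) : maxLoad x ≤ ∑ i, x i :=
  Finset.sup_le fun i _ => Finset.single_le_sum (fun _ _ => Nat.zero_le _) (Finset.mem_univ i)

lemma maxLoad_le_of_forall_le {n : ℕ} [NeZero n] {x : Fin n → ℕ} {b : ℝ}
    (h : ∀ i, (x i : ℝ) ≤ b) : (maxLoad x : ℝ) ≤ b := by
  obtain ⟨i, _, hi⟩ := Finset.exists_mem_eq_sup Finset.univ Finset.univ_nonempty x
  rw [maxLoad, hi]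
  exact h i

/-- The union of the failure probabilities at all times `t, …, t + m ^ 2` is small. -/
lemma union_bound_le {k : ℝ} {n m T : ℕ} (hn : 100 ≤ n) (hnm : n ≤ m)
    (hmk : (m : ℝ) ≤ (n : ℝ) ^ k) (hT : (T : ℝ) ≤ 2309 * m ^ 2)
    (hlog : (6 * k + 2) * Real.log n ≤ n / 36928) :
    ((m : ℝ) ^ 2 + 1) * ((T + 1) * (Real.exp (-(n / 36928)) +
      n * Real.exp (-((6 * k + 3) * Real.log n)))) ≤ (n : ℝ) ^ (-(2 * k)) := by
  have hn0 : (0 : ℝ) < n := by positivity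
  have hn100 : (100 : ℝ) ≤ n := by exact_mod_cast hn
  have hm1 : (1 : ℝ) ≤ m := by exact_mod_cast (by omega : 1 ≤ m)
  set P : ℝ := (n : ℝ) ^ (-(6 * k + 2)) with hP
  have hP0 : 0 < P := Real.rpow_pos_of_pos hn0 _
  have h1 : Real.exp (-(n / 36928)) ≤ P := by
    rw [hP, Real.rpow_def_of_pos hn0]
    exact Real.exp_le_exp.2 (by linarith)
  have h2 : n * Real.exp (-((6 * k + 3) * Real.log n)) = P := by
    rw [hP, Real.rpow_def_of_pos hn0]
    nth_rewrite 1 [← Real.exp_log hn0]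
    rw [← Real.exp_add]
    ring_nf
  have h3 : (m : ℝ) ^ 4 ≤ (n : ℝ) ^ (4 * k) := by
    have : (n : ℝ) ^ (4 * k) = ((n : ℝ) ^ k) ^ 4 := by
      rw [← Real.rpow_natCast, ← Real.rpow_mul hn0.le]; norm_num [mul_comm]
    rw [this]
    gcongr
  have h4 : (n : ℝ) ^ (4 * k) * P * (n : ℝ) ^ 2 = (n : ℝ) ^ (-(2 * k)) := by
    rw [hP, ← Real.rpow_natCast, ← Real.rpow_add hn0, ← Real.rpow_add hn0]
    congr 1
    push_cast
    ring
  have hm2 : (1 : ℝ) ≤ (m : ℝ) ^ 2 := one_le_pow₀ hm1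
  calc ((m : ℝ) ^ 2 + 1) * ((T + 1) * (Real.exp (-(n / 36928)) +
        n * Real.exp (-((6 * k + 3) * Real.log n))))
      ≤ (2 * m ^ 2) * ((2310 * m ^ 2) * (P + P)) := by
        rw [h2]
        gcongr <;> linarith
    _ = 9240 * (m ^ 4 * P) := by ring
    _ ≤ n ^ 2 * ((n : ℝ) ^ (4 * k) * P) := by
        have : (9240 : ℝ) ≤ n ^ 2 := by nlinarith
        gcongr
    _ = (n : ℝ) ^ (-(2 * k)) := by rw [← h4]; ring

end MaxLoad

theorem mainTheorem2 (k : ℝ) (hk : 1 ≤ k) :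
    ∃ C : ℝ, 0 < C ∧
      ∀ (n m : ℕ), 0 < n → n ≤ m → (m : ℝ) ≤ (n : ℝ) ^ k →
      ∀ (Ω : Type*) [MeasurableSpace Ω] (μ : MeasureTheory.Measure Ω)
        [MeasureTheory.IsProbabilityMeasure μ]
        (x₀ : Fin n → ℕ) (Z : ℕ → Fin n → Ω → Fin n) (x : ℕ → Ω → Fin n → ℕ),
        ∑ i, x₀ i = m → IsRBB μ x₀ Z x →
        ∀ t : ℕ, convergenceConst * ((m : ℝ) ^ 2 / (n : ℝ)) ≤ (t : ℝ) →
          1 - (n : ℝ) ^ (-(2 * k)) ≤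
            μ.real {ω | ∀ s : ℕ, t ≤ s → s ≤ t + m ^ 2 →
              (maxLoad (x s ω) : ℝ) ≤ C * ((m : ℝ) / (n : ℝ)) * Real.log (n : ℝ)} := by
  obtain ⟨N, hN⟩ : ∃ N : ℕ, ∀ n : ℕ, N ≤ n → (6 * k + 2) * Real.log n ≤ n / 36928 := by
    have h := Real.isLittleO_log_id_atTop.def
      (by positivity : (0 : ℝ) < 1 / (36928 * (6 * k + 2)))
    obtain ⟨N, hN⟩ := Filter.eventually_atTop.1 (tendsto_natCast_atTop_atTop.eventually h)
    refine ⟨N, fun n hn => ?_⟩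
    have h1 := (le_abs_self _).trans (hN n hn)
    simp only [id, Real.norm_natCast] at h1
    calc (6 * k + 2) * Real.log n ≤ (6 * k + 2) * (1 / (36928 * (6 * k + 2)) * n) := by gcongr
      _ = n / 36928 := by field_simp
  have hlog2 : 0 < Real.log 2 := Real.log_pos one_lt_two
  refine ⟨2308 * (6 * k + 3) + 2 + ((N + 100 : ℕ) : ℝ) / Real.log 2, by positivity, ?_⟩
  intro n m hn hnm hmk Ω _ μ _ x₀ Z x hx hrbb t ht
  have : NeZero n := ⟨hn.ne'⟩
  have hn0 : (0 : ℝ) < n := by exact_mod_cast hn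
  set r : ℝ := m / n with hr
  have hrn : r * n = m := by rw [hr]; field_simp
  have hr1 : 1 ≤ r := by rw [hr, one_le_div hn0]; exact_mod_cast hnm
  have hr0 : 0 < r := by linarith
  rcases Nat.lt_or_ge n 2 with hn2 | hn2
  · obtain rfl : n = 1 := by omega
    simp
  have hlogn : Real.log 2 ≤ Real.log n :=
    Real.log_le_log two_pos (by exact_mod_cast hn2)
  rcases Nat.lt_or_ge n (N + 100) with hsmall | hlarge
  · -- For bounded `n` even the load `m` is small enough.
    have huniv : {ω | ∀ s : ℕ, t ≤ s → s ≤ t + m ^ 2 → (maxLoad (x s ω) : ℝ) ≤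
        (2308 * (6 * k + 3) + 2 + ((N + 100 : ℕ) : ℝ) / Real.log 2) * r * Real.log n} =
          Set.univ := by
      refine Set.eq_univ_of_forall fun ω s _ _ => ?_
      have h1 : (maxLoad (x s ω) : ℝ) ≤ m := by
        rw [hrbb.eq_rbbProc, ← hx, ← sum_rbbProc x₀ (fun p => Z p.1 p.2 ω) s]
        exact_mod_cast maxLoad_le_sum _
      calc (maxLoad (x s ω) : ℝ) ≤ r * n := by rw [hrn]; exact h1
        _ ≤ r * (N + 100 : ℕ) := by gcongr
        _ = ((N + 100 : ℕ) : ℝ) / Real.log 2 * r * Real.log 2 := by field_simp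
        _ ≤ _ := by
          gcongr
          have : 0 ≤ 2308 * (6 * k + 3) + 2 := by positivity
          linarith
    rw [huniv, MeasureTheory.probReal_univ]
    have := Real.rpow_nonneg hn0.le (-(2 * k))
    linarith
  have hm0 : 0 < m := by omega
  have hlog1 : 1 ≤ Real.log n := by
    rw [Real.le_log_iff_exp_le hn0]
    have h1 := Real.exp_one_lt_d9
    have h2 : (100 : ℝ) ≤ n := by exact_mod_cast (by omega : 100 ≤ n)
    linarith
  set L : ℝ := (6 * k + 3) * Real.log n with hL
  set T : ℕ := ⌈2308 * r * (r * n)⌉₊ with hT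
  have hrr : r * (r * n) = (m : ℝ) ^ 2 / n := by rw [hr]; field_simp
  have hrm : r * (r * n) ≤ (m : ℝ) ^ 2 := by
    rw [hrr]
    exact div_le_self (by positivity) (by exact_mod_cast hn)
  have hrr1 : 1 ≤ r * (r * n) := by
    rw [hrn]; exact one_le_mul_of_one_le_of_one_le hr1 (by exact_mod_cast hm0)
  have hT1 : 2308 * r * (r * n) ≤ T := Nat.le_ceil _
  have hT2 : (T : ℝ) ≤ 2309 * (r * (r * n)) := by
    have := (Nat.ceil_lt_add_one (by positivity : 0 ≤ 2308 * r * (r * n))).le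
    linarith
  have hTt : T ≤ t := by
    have : (T : ℝ) ≤ t := by
      refine hT2.trans (le_trans ?_ ht)
      rw [hrr, convergenceConst]
      gcongr
      norm_num
    exact_mod_cast this
  set G : Set Ω := {ω | ∀ s : ℕ, t ≤ s → s ≤ t + m ^ 2 → (maxLoad (x s ω) : ℝ) ≤
        (2308 * (6 * k + 3) + 2 + ((N + 100 : ℕ) : ℝ) / Real.log 2) * r * Real.log n} with hG
  have hbound : 2308 * r * L + r / 2 + 1 ≤
      (2308 * (6 * k + 3) + 2 + ((N + 100 : ℕ) : ℝ) / Real.log 2) * r * Real.log n := by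
    have h1 : r ≤ r * Real.log n := le_mul_of_one_le_right hr0.le hlog1
    have h2 : 0 ≤ ((N + 100 : ℕ) : ℝ) / Real.log 2 * r * Real.log n := by positivity
    rw [hL]
    nlinarith
  have hGc : Gᶜ ⊆ ⋃ s ∈ Finset.Icc t (t + m ^ 2),
      {ω | ∃ i, 2308 * r * L + r / 2 + 1 < rbbProc x₀ (fun p => Z p.1 p.2 ω) s i} := by
    intro ω hω
    by_contra hnot
    simp only [Set.mem_iUnion, not_exists, Set.mem_ofPred_eq, not_lt] at hnot
    refine hω fun s hs hs' => ?_
    rw [hrbb.eq_rbbProc]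
    exact maxLoad_le_of_forall_le fun i =>
      (hnot s (Finset.mem_Icc.2 ⟨hs, hs'⟩) i).trans hbound
  have hGc' : μ.real Gᶜ ≤ (n : ℝ) ^ (-(2 * k)) := by
    refine (MeasureTheory.measureReal_mono hGc (MeasureTheory.measure_ne_top _ _)).trans
      ((MeasureTheory.measureReal_biUnion_finset_le _ _).trans ?_)
    refine (Finset.sum_le_card_nsmul _ _ _ fun s hs => measureReal_exists_rbbProc_gt_le
      (Y := fun p : ℕ × Fin n => Z p.1 p.2) (fun p => hrbb.measurable _ _) hrbb.indep
      (fun p => hrbb.uniform _ _) x₀ hn2 hr1 (by rw [hx, hrn]) hT1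
      (hTt.trans (Finset.mem_Icc.1 hs).1)).trans ?_
    refine le_trans (le_of_eq ?_) (union_bound_le (T := T) (by omega) hnm hmk
      (hT2.trans (by linarith)) (hN n (by omega)))
    have hcard : t + m ^ 2 + 1 - t = m ^ 2 + 1 := by omega
    rw [Nat.card_Icc, nsmul_eq_mul, hcard]
    push_cast
    rfl
  have htotal : 1 ≤ μ.real G + μ.real Gᶜ := by
    rw [← MeasureTheory.probReal_univ (μ := μ), ← Set.union_compl_self G]
    exact MeasureTheory.measureReal_union_le _ _
  linarith
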